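/- Let $E$ be a finite set and $\mathcal{L}\subseteq 2^E$. For $e\in E$ the toggle $t_e:\mathcal{L}\to\mathcal{L}$ sends $X$ to $X\cup\{e\}$ if $e\notin X$ and $X\cup\{e\}\in\mathcal{L}$, to $X\setminus\{e\}$ if $e\in X$ and $X\setminus\{e\}\in\mathcal{L}$, and to $X$ otherwise. The toggle group $T(\mathcal{L})$ is the subgroup of the symmetric group $\mathfrak{S}_{\mathcal{L}}$ generated by all $t_e$, $e\in E$, and $\mathcal{L}$ is called toggle-alternating if $T(\mathcal{L})$ contains the alternating group $A_{\mathcal{L}}$. Let $G$ be a finite simple graph with vertex set $V(G)$, and let $\mathcal{IS}(G)\subseteq 2^{V(G)}$ be the set of independent sets of $G$, that is, of the sets of vertices no two of which are joined by an edge. 1. If $G$ is connected, then $\mathcal{IS}(G)$ is toggle-alternating. 2. If $G$ has connected components $G_1,\dots,G_k$, then $T(\mathcal{IS}(G))$ is the direct product of the toggle groups of the components: there is a group isomorphism $$\varphi: T(\mathcal{IS}(G))\to T(\mathcal{IS}(G_1))\times\cdots\times T(\mathcal{IS}(G_k)),\qquad g\mapsto(g_1,\dots,g_k),$$ such that $g_i(X\cap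 V(G_i))=g(X)\cap V(G_i)$ for all $g\in T(\mathcal{IS}(G))$, all $X\in\mathcal{IS}(G)$ and all $i$. -/

import Mathlib

namespace ToggleGroup

open scoped Classical in
/-- The toggle `t_e` of a family `L` of subsets of `E`, as a map `L → L`: add `e` if `e ∉ X` and the
result is in `L`, remove `e` if `e ∈ X` and the result is in `L`, and fix `X` otherwise. -/
noncomputable def toggleFun {E : Type*} (L : Set (Set E)) (e : E) (X : L) : L :=
  if h : e ∉ X.1 ∧ X.1 ∪ {e} ∈ L then ⟨X.1 ∪ {e}, h.2⟩
  else if h : e ∈ X.1 ∧ X.1 \ {e} ∈ L then ⟨X.1 \ {e}, h.2⟩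
  else X

theorem toggleFun_involutive {E : Type*} (L : Set (Set E)) (e : E) :
    Function.Involutive (toggleFun L e) := by
  rintro ⟨X, hX⟩
  by_cases he : e ∈ X
  · by_cases hL : X \ {e} ∈ L
    · have h1 : toggleFun L e ⟨X, hX⟩ = ⟨X \ {e}, hL⟩ := by simp [toggleFun, he, hL]
      have h2 : X \ {e} ∪ {e} = X := by
        rw [Set.sdiff_union_self, Set.union_eq_left]; simpa using he
      rw [h1]
      apply Subtype.ext
      rw [toggleFun, dif_pos ⟨by simp, by rw [h2]; exact hX⟩]
      exact h2
    · have h1 : toggleFun L e ⟨X, hX⟩ = ⟨X, hX⟩ := by simp [toggleFun, he, hL]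
      rw [h1, h1]
  · by_cases hL : X ∪ {e} ∈ L
    · have h1 : toggleFun L e ⟨X, hX⟩ = ⟨X ∪ {e}, hL⟩ := by
        rw [toggleFun, dif_pos ⟨he, hL⟩]
      have h2 : (X ∪ {e}) \ {e} = X := by
        rw [Set.union_sdiff_right]; exact Set.sdiff_singleton_eq_self he
      rw [h1]
      apply Subtype.ext
      rw [toggleFun, dif_neg (by simp), dif_pos ⟨by simp, by rw [h2]; exact hX⟩]
      exact h2
    · have h1 : toggleFun L e ⟨X, hX⟩ = ⟨X, hX⟩ := by
        rw [toggleFun, dif_neg (fun h => hL h.2), dif_neg (fun h => he h.1)]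
      rw [h1, h1]

/-- The toggle `t_e` as a permutation of `L`. -/
noncomputable def toggle {E : Type*} (L : Set (Set E)) (e : E) : Equiv.Perm L :=
  (toggleFun_involutive L e).toPerm

/-- The toggle group `T(L)`: the subgroup of the symmetric group on `L` generated by the toggles. -/
def toggleGroup {E : Type*} (L : Set (Set E)) : Subgroup (Equiv.Perm L) :=
  Subgroup.closure (Set.range (toggle L))

open scoped Classical in
/-- `L` is toggle-alternating if `T(L)` contains the alternating group on `L`. -/
def ToggleAlternating {E : Type*} [Finite E] (L : Set (Set E)) : Prop :=
  letI : Fintype L := Fintype.ofFinite L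
  alternatingGroup L ≤ toggleGroup L

/-- The family `IS(G)` of independent sets of vertices of `G`. -/
def indepSets {V : Type*} (G : SimpleGraph V) : Set (Set V) :=
  {X | G.IsIndepSet X}

/-- The part `X ∩ V(C)` of an independent set `X` of `G` in a connected component `C`, as an
independent set of the graph `C`. -/
def restrictToComponent {V : Type*} {G : SimpleGraph V} (C : G.ConnectedComponent)
    (X : indepSets G) : indepSets C.toSimpleGraph :=
  ⟨Subtype.val ⁻¹' X.1, fun _ hu _ hv huv hadj =>
    X.2 hu hv (fun h => huv (Subtype.ext h)) hadj⟩

end ToggleGroup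

/-! Toggling vertices out of any independent set reaches the empty set, so the action is transitive.
For connected `G`, delete a non-cut vertex `v`. Since `v` has a neighbour, the sets avoiding `v`
outnumber those containing it, and they carry the toggle group of `G - v`. Induction then gives
primitivity (`isPreprimitive_toggleGroup`), so by Jordan's theorems one transposition or 3-cycle
suffices. A vertex adjacent to all others toggles as a transposition. Otherwise, simplicity of the
alternating group on the sets avoiding `v` yields a word in the other toggles that is a 3-cycle
there and trivial on the smaller family containing `v` (`exists_isThreeCycle_of_card_lt`). For
components, an independent set is a tuple of independent sets, and each toggle moves one coordinate.
-/

namespace ToggleGroup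

open MulAction Equiv.Perm

section Toggles

variable {V : Type*} {G : SimpleGraph V}

theorem mem_toggle_indepSets (v w : V) (X : indepSets G) :
    w ∈ (toggle (indepSets G) v X).1 ↔
      (w ≠ v ∧ w ∈ X.1) ∨ (w = v ∧ v ∉ X.1 ∧ ∀ u ∈ X.1, ¬ G.Adj v u) := by
  have hsub : v ∈ X.1 → X.1 \ {v} ∈ indepSets G := fun _ => X.2.mono Set.sdiff_subset
  have hins : v ∉ X.1 → (X.1 ∪ {v} ∈ indepSets G ↔ ∀ u ∈ X.1, ¬ G.Adj v u) := by
    intro hv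
    simp only [indepSets, Set.mem_ofPred_eq, Set.union_singleton, SimpleGraph.IsIndepSet]
    have : Std.Symm fun a b => ¬ G.Adj a b := ⟨fun a b h h' => h h'.symm⟩
    rw [Set.pairwise_insert_of_symm]
    exact ⟨fun h u hu => h.2 u hu (fun h' => hv (h' ▸ hu)), fun h => ⟨X.2, fun u hu _ => h u hu⟩⟩
  change w ∈ (toggleFun (indepSets G) v X).1 ↔ _
  by_cases hv : v ∈ X.1
  · have h := hsub hv
    simp only [toggleFun, hv, h, not_true_eq_false, false_and, dite_false, and_self, dite_true]
    simp
    tauto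
  · by_cases h : ∀ u ∈ X.1, ¬ G.Adj v u
    · have h' := (hins hv).2 h
      rw [toggleFun, dif_pos ⟨hv, h'⟩]
      by_cases hw : w = v <;> simp [hw, hv]
      exact h
    · have h' := fun h' => h ((hins hv).1 h')
      rw [toggleFun, dif_neg (fun h => h' h.2), dif_neg (fun h => hv h.1)]
      by_cases hw : w = v
      · subst hw; tauto
      · simp [hw]

theorem toggle_mem_toggleGroup {E : Type*} (L : Set (Set E)) (e : E) :
    toggle L e ∈ toggleGroup L :=
  Subgroup.subset_closure ⟨e, rfl⟩

/-- The empty independent set. -/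
def emptyIndepSet (G : SimpleGraph V) : indepSets G :=
  ⟨∅, by simp [indepSets, SimpleGraph.IsIndepSet]⟩

theorem exists_toggleGroup_smul_empty [Finite V] (X : indepSets G) :
    ∃ g : toggleGroup (indepSets G), g • emptyIndepSet G = X := by
  obtain ⟨X, hX⟩ := X
  induction X, X.toFinite using Set.Finite.induction_on with
  | empty => exact ⟨1, one_smul _ _⟩
  | @insert v X hv _ ih =>
    have hX' : X ∈ indepSets G := hX.mono (Set.subset_insert v X)
    obtain ⟨g, hg⟩ := ih hX'
    refine ⟨⟨_, toggle_mem_toggleGroup _ v⟩ * g, ?_⟩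
    rw [mul_smul, hg]
    apply Subtype.ext
    ext w
    change w ∈ (toggle (indepSets G) v ⟨X, hX'⟩).1 ↔ _
    rw [mem_toggle_indepSets]
    have : ∀ u ∈ X, ¬ G.Adj v u := fun u hu =>
      hX (Set.mem_insert v X) (Set.mem_insert_of_mem v hu) (fun h => hv (h ▸ hu))
    by_cases hw : w = v
    · simp only [hw]; simp [hv]; exact this
    · simp [hw]

instance isPretransitive_toggleGroup [Finite V] :
    IsPretransitive (toggleGroup (indepSets G)) (indepSets G) where
  exists_smul_eq X Y := by
    obtain ⟨g, rfl⟩ := exists_toggleGroup_smul_empty X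
    obtain ⟨h, rfl⟩ := exists_toggleGroup_smul_empty Y
    exact ⟨h * g⁻¹, by simp [mul_smul]⟩

end Toggles

/-! ### Independent sets avoiding a vertex -/

section Induce

variable {V : Type*} {G : SimpleGraph V} {s : Set V}

/-- An independent set of an induced subgraph, as an independent set of the whole graph. -/
def extendIndepSet (X : indepSets (G.induce s)) : indepSets G :=
  ⟨Subtype.val '' X.1, by
    rintro _ ⟨a, ha, rfl⟩ _ ⟨b, hb, rfl⟩ hab
    exact X.2 ha hb (fun h => hab (h ▸ rfl))⟩

theorem extendIndepSet_injective :
    Function.Injective (extendIndepSet : indepSets (G.induce s) → indepSets G) := fun _ _ h =>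
  Subtype.ext (Subtype.val_injective.image_injective (congrArg Subtype.val h))

theorem extendIndepSet_toggle (w : s) (X : indepSets (G.induce s)) :
    extendIndepSet (toggle (indepSets (G.induce s)) w X) =
      toggle (indepSets G) w.1 (extendIndepSet X) := by
  apply Subtype.ext
  ext u
  rw [mem_toggle_indepSets]
  simp only [extendIndepSet, Set.mem_image]
  constructor
  · rintro ⟨a, ha, rfl⟩
    rw [mem_toggle_indepSets] at ha
    simpa [Subtype.ext_iff] using ha
  · intro h
    have hu : u ∈ s := by
      rcases h with ⟨_, a, _, rfl⟩ | ⟨rfl, _⟩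
      exacts [a.2, w.2]
    refine ⟨⟨u, hu⟩, ?_, rfl⟩
    rw [mem_toggle_indepSets]
    simpa [Subtype.ext_iff, hu] using h

theorem exists_extendIndepSet_eq {X : indepSets G} (h : X.1 ⊆ s) :
    ∃ Y : indepSets (G.induce s), extendIndepSet Y = X :=
  ⟨⟨Subtype.val ⁻¹' X.1, fun _ hu _ hv huv => X.2 hu hv (fun h => huv (Subtype.ext h))⟩,
    Subtype.ext (by simp [extendIndepSet, Set.inter_eq_right.2 h])⟩

/-- Lift a word in the toggles letter by letter. Different words for `g` may act differently on sets
not inside `s`, so `h` is merely chosen; equivariance needs no more. -/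
theorem exists_toggleGroup_extendIndepSet (g : toggleGroup (indepSets (G.induce s))) :
    ∃ h : toggleGroup (indepSets G), ∀ X : indepSets (G.induce s),
      extendIndepSet (g • X) = h • extendIndepSet X := by
  obtain ⟨g, hg⟩ := g
  induction hg using Subgroup.closure_induction with
  | mem g hg =>
    obtain ⟨w, rfl⟩ := hg
    exact ⟨⟨_, toggle_mem_toggleGroup _ w.1⟩, fun X => extendIndepSet_toggle w X⟩
  | one => exact ⟨1, fun X => by simp [Subgroup.smul_def]⟩
  | mul x y hx hy ihx ihy =>
    obtain ⟨a, ha⟩ := ihx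
    obtain ⟨b, hb⟩ := ihy
    refine ⟨a * b, fun X => ?_⟩
    rw [mul_smul, ← hb, ← ha]
    rfl
  | inv x hx ih =>
    obtain ⟨a, ha⟩ := ih
    refine ⟨a⁻¹, fun X => ?_⟩
    rw [eq_inv_smul_iff, ← ha]
    congr 1
    exact x.apply_symm_apply X

theorem card_indepSets_containing_lt [Finite V] {v w : V} (hvw : G.Adj v w) :
    Nat.card {X : indepSets G // v ∈ X.1} < Nat.card (indepSets (G.induce ({v}ᶜ : Set V))) := by
  classical
  let f : {X : indepSets G // v ∈ X.1} → indepSets (G.induce ({v}ᶜ : Set V)) := fun X =>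
    ⟨Subtype.val ⁻¹' X.1.1, fun _ hu _ hv huv => X.1.2 hu hv (fun h => huv (Subtype.ext h))⟩
  have hf : Function.Injective f := by
    intro X Y h
    apply Subtype.ext
    apply Subtype.ext
    ext u
    by_cases hu : u = v
    · subst hu; exact iff_of_true X.2 Y.2
    · exact Set.ext_iff.1 (congrArg Subtype.val h) ⟨u, hu⟩
  refine (Nat.card_le_card_of_injective f hf).lt_of_ne fun hcard => ?_
  have hs := ((Nat.bijective_iff_injective_and_card f).2 ⟨hf, hcard⟩).2
  -- Deleting `v` never produces `{w}`, because `v` and `w` are adjacent.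
  obtain ⟨X, hX⟩ := hs ⟨{⟨w, hvw.ne'⟩}, by simp [indepSets, SimpleGraph.IsIndepSet]⟩
  have : w ∈ X.1.1 := by
    have := Set.ext_iff.1 (congrArg Subtype.val hX) ⟨w, hvw.ne'⟩
    simpa [f] using this
  exact X.1.2 X.2 this hvw.ne hvw

theorem mem_range_extendIndepSet_compl {v : V} {X : indepSets G} :
    X ∈ Set.range (extendIndepSet (G := G) (s := {v}ᶜ)) ↔ v ∉ X.1 := by
  constructor
  · rintro ⟨Y, rfl⟩ ⟨a, _, ha⟩
    exact a.2 ha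
  · intro h
    exact exists_extendIndepSet_eq (fun a ha h' => h (Set.mem_singleton_iff.1 h' ▸ ha))

theorem card_indepSets_lt_two_mul [Finite V] {v w : V} (hvw : G.Adj v w) :
    Nat.card (indepSets G) < 2 * (Set.range (extendIndepSet (G := G) (s := {v}ᶜ))).ncard := by
  have h1 := Set.ncard_add_ncard_compl (Set.range (extendIndepSet (G := G) (s := {v}ᶜ)))
  have h2 : (Set.range (extendIndepSet (G := G) (s := {v}ᶜ)))ᶜ.ncard =
      Nat.card {X : indepSets G // v ∈ X.1} := by
    rw [← Nat.card_coe_set_eq]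
    exact Nat.card_congr (Equiv.subtypeEquivRight fun X => by
      rw [Set.mem_compl_iff, mem_range_extendIndepSet_compl, not_not])
  have h3 := card_indepSets_containing_lt hvw
  rw [← Set.ncard_range_of_injective (extendIndepSet_injective (G := G))] at h3
  omega

end Induce

/-! ### Primitivity -/

theorem isPreprimitive_toggleGroup {V : Type*} [Finite V] {G : SimpleGraph V}
    (hG : G.Connected) : IsPreprimitive (toggleGroup (indepSets G)) (indepSets G) := by
  induction h : Nat.card V using Nat.strong_induction_on generalizing V with
  | _ n ih =>
  rcases subsingleton_or_nontrivial V with hV | hV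
  · have hcard : Nat.card (indepSets G) ≤ 2 := by
      refine (Nat.card_le_card_of_injective _ Subtype.val_injective).trans ?_
      have := Fintype.ofFinite V
      rw [Nat.card_eq_fintype_card, Fintype.card_set]
      exact Nat.pow_le_pow_right two_pos (Fintype.card_le_one_iff_subsingleton.2 hV)
    exact ⟨fun {B} _ => isTrivialBlock_of_card_le_two hcard B⟩
  · obtain ⟨v, hv⟩ := hG.exists_connected_induce_compl_singleton_of_finite_nontrivial
    obtain ⟨w, hw⟩ := hG.preconnected.exists_adj_of_nontrivial v
    have hlt : Nat.card ({v}ᶜ : Set V) < n := by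
      rw [← h]
      exact Finite.card_subtype_lt (x := v) (by simp)
    have := ih _ hlt hv rfl
    choose φ hφ using exists_toggleGroup_extendIndepSet (G := G) (s := {v}ᶜ)
    let f : indepSets (G.induce ({v}ᶜ : Set V)) →ₑ[φ] indepSets G :=
      ⟨extendIndepSet, hφ⟩
    -- A transitive action is primitive once a primitive one maps equivariantly onto more than half
    -- of it.
    exact IsPreprimitive.of_card_lt (f := f) (card_indepSets_lt_two_mul hw)

/-! ### Producing a 3-cycle -/

/-- A Goursat-type argument: elements acting trivially on `β` have normal image in the simple group
`alternatingGroup α`. A trivial image would make `|α|!/2` divide the order of a group of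
permutations of `β`, which is too small. -/
theorem exists_isThreeCycle_of_card_lt {P α β : Type*} [Group P] [Fintype α] [DecidableEq α]
    [Finite β] (a : P →* Equiv.Perm α) (b : P →* Equiv.Perm β)
    (ha : alternatingGroup α ≤ a.range) (h5 : 5 ≤ Nat.card α) (hβ : Nat.card β < Nat.card α) :
    ∃ p, b p = 1 ∧ (a p).IsThreeCycle := by
  have := alternatingGroup.isSimpleGroup (α := α) h5
  let a' := a.subgroupComap (alternatingGroup α)
  have ha' : Function.Surjective a' := fun ⟨x, hx⟩ => by
    obtain ⟨p, rfl⟩ := ha hx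
    exact ⟨⟨p, hx⟩, rfl⟩
  let b' := b.comp ((alternatingGroup α).comap a).subtype
  have : Nontrivial α := Finite.one_lt_card_iff_nontrivial.1 (by omega)
  have hN : (b'.ker.map a').Normal := Subgroup.Normal.map inferInstance a' ha'
  rcases hN.eq_bot_or_eq_top with h | h
  · exfalso
    have hle : b'.ker ≤ a'.ker := (Subgroup.map_eq_bot_iff _).1 h
    have hdvd := Subgroup.index_dvd_of_le hle
    rw [Subgroup.index_ker, Subgroup.index_ker, MonoidHom.range_eq_top.2 ha',
      Subgroup.card_top] at hdvd
    have h1 := Nat.le_of_dvd Nat.card_pos hdvd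
    have h2 : Nat.card b'.range ≤ Nat.card (Equiv.Perm β) := Subgroup.card_le_card_group _
    rw [Nat.card_perm] at h2
    have h3 : 2 * Nat.card (alternatingGroup α) = _ := two_mul_nat_card_alternatingGroup
    rw [Nat.card_perm] at h3
    obtain ⟨n, hn⟩ : ∃ n, Nat.card α = n + 1 := ⟨Nat.card α - 1, by omega⟩
    rw [hn, Nat.factorial_succ] at h3
    have h4 : (Nat.card β).factorial ≤ n.factorial := Nat.factorial_le (by omega)
    have h5 : 5 * n.factorial ≤ (n + 1) * n.factorial := Nat.mul_le_mul_right _ (by omega)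
    have := n.factorial_pos
    omega
  · obtain ⟨x, y, z, hxy, hxz, hyz⟩ := (Fintype.two_lt_card_iff (α := α)).1
      (by rw [← Nat.card_eq_fintype_card]; omega)
    have h3 := isThreeCycle_swap_mul_swap_same hxy hxz hyz
    have hmem : (⟨_, h3.mem_alternatingGroup⟩ : alternatingGroup α) ∈ b'.ker.map a' := by
      rw [h]; trivial
    obtain ⟨p, hp, hp'⟩ := hmem
    refine ⟨p.1, hp, ?_⟩
    have : a p.1 = _ := congrArg Subtype.val hp'
    rw [this]
    exact h3

theorem lift_apply_of_semiconj {ι α β : Type*} {t : ι → Equiv.Perm α} {u : ι → Equiv.Perm β}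
    {f : α → β} (h : ∀ i x, f (t i x) = u i (f x)) (p : FreeGroup ι) (x : α) :
    f (FreeGroup.lift t p x) = FreeGroup.lift u p (f x) := by
  induction p using FreeGroup.induction_on generalizing x with
  | C1 => simp
  | of i => simpa using h i x
  | inv_of i ih =>
    simp only [map_inv, FreeGroup.lift_apply_of]
    rw [eq_comm, Equiv.Perm.inv_eq_iff_eq, ← h]
    simp
  | mul p q hp hq => simp [hp, hq]

theorem isThreeCycle_of_injective {α β : Type*} [Fintype α] [DecidableEq α] [Fintype β]
    [DecidableEq β] {f : α → β} (hf : Function.Injective f) {c : Equiv.Perm α} {g : Equiv.Perm β}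
    (hc : c.IsThreeCycle) (hfg : ∀ x, g (f x) = f (c x)) (hg : ∀ y ∉ Set.range f, g y = y) :
    g.IsThreeCycle := by
  classical
  have : g = c.extendDomain (Equiv.ofInjective f hf) := by
    ext y
    by_cases hy : y ∈ Set.range f
    · obtain ⟨x, rfl⟩ := hy
      rw [hfg]
      exact (extendDomain_apply_image c (Equiv.ofInjective f hf) x).symm
    · rw [hg y hy, extendDomain_apply_not_subtype _ _ hy]
  rw [this, Equiv.Perm.IsThreeCycle, cycleType_extendDomain]
  exact hc

section Alternating

variable {V : Type*} {G : SimpleGraph V}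

open scoped Classical in
theorem isSwap_toggle_of_forall_adj {v : V} (hv : ∀ u, u ≠ v → G.Adj v u) :
    (toggle (indepSets G) v).IsSwap := by
  have hX : ∀ X : indepSets G, v ∈ X.1 → X.1 = {v} := fun X h => by
    ext w
    refine ⟨fun hw => ?_, fun hw => hw ▸ h⟩
    by_contra hwv
    exact X.2 h hw (Ne.symm hwv) (hv w hwv)
  have hv' : ({v} : Set V) ∈ indepSets G := by simp [indepSets, SimpleGraph.IsIndepSet]
  refine ⟨emptyIndepSet G, ⟨{v}, hv'⟩, fun h => ?_, ?_⟩
  · exact (Set.singleton_nonempty v).ne_empty (congrArg Subtype.val h).symm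
  ext1 X
  apply Subtype.ext
  rw [Equiv.swap_apply_def]
  split_ifs with h1 h2
  · subst h1
    ext w
    rw [mem_toggle_indepSets]
    simp [emptyIndepSet]
  · subst h2
    ext w
    rw [mem_toggle_indepSets]
    simp [emptyIndepSet]
  · have h3 : v ∉ X.1 := fun h => h2 (Subtype.ext (hX X h))
    have h4 : ∃ u ∈ X.1, G.Adj v u := by
      obtain ⟨u, hu⟩ := Set.nonempty_iff_ne_empty.2 fun h => h1 (Subtype.ext h)
      exact ⟨u, hu, hv u fun h => h3 (h ▸ hu)⟩
    ext w
    rw [mem_toggle_indepSets]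
    by_cases hw : w = v
    · subst hw
      obtain ⟨u, hu, huv⟩ := h4
      simp only [h3, iff_false]
      rintro (⟨h, _⟩ | ⟨_, _, h⟩)
      exacts [h rfl, h u hu huv]
    · simp [hw]

theorem five_le_card_indepSets [Finite V] {u w x : V} (huw : u ≠ w) (hux : u ≠ x) (hwx : w ≠ x)
    (h : ¬ G.Adj u w) : 5 ≤ Nat.card (indepSets G) := by
  have hpair : ({u, w} : Set V) ∈ indepSets G := by
    rintro a (rfl | rfl) b (rfl | rfl) hab
    exacts [(hab rfl).elim, h, fun h' => h h'.symm, (hab rfl).elim]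
  have hsing : ∀ a, ({a} : Set V) ∈ indepSets G := fun a => by
    simp [indepSets, SimpleGraph.IsIndepSet]
  let l : Fin 5 → indepSets G :=
    ![emptyIndepSet G, ⟨{u}, hsing u⟩, ⟨{w}, hsing w⟩, ⟨{x}, hsing x⟩, ⟨{u, w}, hpair⟩]
  have hl : Function.Injective l := by
    intro i j hij
    have h1 := Set.ext_iff.1 (congrArg Subtype.val hij) u
    have h2 := Set.ext_iff.1 (congrArg Subtype.val hij) w
    have h3 := Set.ext_iff.1 (congrArg Subtype.val hij) x
    fin_cases i <;> fin_cases j <;> first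
      | rfl
      | simp [l, emptyIndepSet, huw, hux, hwx, huw.symm] at h1 h2 h3
  simpa using Nat.card_le_card_of_injective l hl

variable [Finite V]

open scoped Classical in
theorem exists_isThreeCycle_mem_toggleGroup [Fintype (indepSets G)] {v w : V} (hvw : G.Adj v w)
    (h5 : 5 ≤ Nat.card (indepSets (G.induce ({v}ᶜ : Set V))))
    (halt : ToggleAlternating (indepSets (G.induce ({v}ᶜ : Set V)))) :
    ∃ g ∈ toggleGroup (indepSets G), g.IsThreeCycle := by
  let s : Set V := {v}ᶜ
  let _ : Fintype (indepSets (G.induce s)) := Fintype.ofFinite _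
  have hB : ∀ (i : s) (X : indepSets G), v ∈ X.1 ↔ v ∈ (toggle (indepSets G) i.1 X).1 := by
    intro i X
    have hi : v ≠ i.1 := fun h => i.2 h.symm
    rw [mem_toggle_indepSets]
    simp [hi]
  -- Relations among toggles of `G - v` need not hold in `G`, so the free group serves as the common
  -- source of all three actions.
  let a : FreeGroup s →* Equiv.Perm (indepSets (G.induce s)) :=
    FreeGroup.lift (toggle (indepSets (G.induce s)))
  let b : FreeGroup s →* Equiv.Perm {X : indepSets G // v ∈ X.1} :=
    FreeGroup.lift fun i => (toggle (indepSets G) i.1).subtypePerm (fun X => (hB i X).symm)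
  let c : FreeGroup s →* Equiv.Perm (indepSets G) :=
    FreeGroup.lift fun i => toggle (indepSets G) i.1
  have ha : alternatingGroup (indepSets (G.induce s)) ≤ a.range := by
    rw [FreeGroup.range_lift_eq_closure]
    exact halt
  obtain ⟨p, hbp, hap⟩ := exists_isThreeCycle_of_card_lt a b ha h5
    (card_indepSets_containing_lt hvw)
  refine ⟨c p, ?_, isThreeCycle_of_injective (f := extendIndepSet) extendIndepSet_injective hap
    (fun X => ?_) (fun Y hY => ?_)⟩
  · have : c p ∈ c.range := ⟨p, rfl⟩
    rw [FreeGroup.range_lift_eq_closure] at this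
    refine Subgroup.closure_mono ?_ this
    rintro _ ⟨i, rfl⟩
    exact ⟨i.1, rfl⟩
  · exact (lift_apply_of_semiconj (f := extendIndepSet) extendIndepSet_toggle p X).symm
  · rw [mem_range_extendIndepSet_compl, not_not] at hY
    have := lift_apply_of_semiconj (f := (Subtype.val : {X : indepSets G // v ∈ X.1} → _))
      (t := fun i : s => (toggle (indepSets G) i.1).subtypePerm (fun X => (hB i X).symm))
      (u := fun i : s => toggle (indepSets G) i.1) (fun i X => rfl) p ⟨Y, hY⟩
    change ((b p) ⟨Y, hY⟩).1 = c p Y at this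
    rw [← this, hbp]
    rfl

end Alternating

/-! ### Connected graphs -/

theorem toggleAlternating_indepSets {V : Type*} [Finite V] {G : SimpleGraph V}
    (hG : G.Connected) : ToggleAlternating (indepSets G) := by
  classical
  induction h : Nat.card V using Nat.strong_induction_on generalizing V with
  | _ n ih =>
  have hprim := isPreprimitive_toggleGroup hG
  by_cases huniv : ∃ v, ∀ u, u ≠ v → G.Adj v u
  · obtain ⟨v, hv⟩ := huniv
    have htop : toggleGroup (indepSets G) = ⊤ :=
      subgroup_eq_top_of_isPreprimitive_of_isSwap_mem hprim _
        (by convert isSwap_toggle_of_forall_adj hv) (toggle_mem_toggleGroup _ v)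
    rw [ToggleAlternating, htop]
    exact le_top
  · push Not at huniv
    have : Nontrivial V := by
      obtain ⟨v⟩ := hG.nonempty
      obtain ⟨u, hu, _⟩ := huniv v
      exact ⟨u, v, hu⟩
    obtain ⟨v, hv⟩ := hG.exists_connected_induce_compl_singleton_of_finite_nontrivial
    obtain ⟨w, hw⟩ := hG.preconnected.exists_adj_of_nontrivial v
    obtain ⟨u, huw, hwu⟩ := huniv w
    have huv : u ≠ v := fun h => hwu (h ▸ hw.symm)
    have : Nontrivial ({v}ᶜ : Set V) :=
      ⟨⟨u, huv⟩, ⟨w, hw.ne'⟩, fun h => huw (congrArg Subtype.val h)⟩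
    -- A third vertex besides the non-adjacent pair `u`, `w` secures five independent sets in `G -
    -- v`, as simplicity requires.
    obtain ⟨x, hx⟩ := hv.preconnected.exists_adj_of_nontrivial ⟨w, hw.ne'⟩
    have h5 : 5 ≤ Nat.card (indepSets (G.induce ({v}ᶜ : Set V))) :=
      five_le_card_indepSets (u := ⟨w, hw.ne'⟩) (w := ⟨u, huv⟩) (x := x)
        (fun h => huw (congrArg Subtype.val h).symm) hx.ne (by rintro rfl; exact hwu hx) hwu
    have hlt : Nat.card ({v}ᶜ : Set V) < n := by
      rw [← h]
      exact Finite.card_subtype_lt (x := v) (by simp)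
    let _ : Fintype (indepSets G) := Fintype.ofFinite _
    obtain ⟨g, hg, hg3⟩ := exists_isThreeCycle_mem_toggleGroup hw h5 (ih _ hlt hv rfl)
    have := alternatingGroup_le_of_isPreprimitive_of_isThreeCycle_mem hprim
      (by convert hg3) hg
    rw [ToggleAlternating]
    convert this

/-! ### Product over components -/

section Components

variable {V : Type*} {G : SimpleGraph V}

theorem restrictToComponent_toggle (C : G.ConnectedComponent) (v : C) (X : indepSets G) :
    restrictToComponent C (toggle (indepSets G) v.1 X) =
      toggle (indepSets C.toSimpleGraph) v (restrictToComponent C X) := by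
  apply Subtype.ext
  ext w
  rw [mem_toggle_indepSets]
  change w.1 ∈ (toggle (indepSets G) v.1 X).1 ↔ _
  rw [mem_toggle_indepSets]
  simp only [restrictToComponent, Set.mem_preimage, ne_eq, Subtype.ext_iff]
  have : (∀ u ∈ X.1, ¬ G.Adj v u) ↔ ∀ u : C, u.1 ∈ X.1 → ¬ C.toSimpleGraph.Adj v u :=
    ⟨fun h u hu => h u hu, fun h u hu hvu =>
      h ⟨u, C.mem_supp_of_adj_mem_supp v.2 hvu⟩ hu hvu⟩
  rw [this]

theorem restrictToComponent_toggle_of_notMem {C : G.ConnectedComponent} {v : V} (hv : v ∉ C.supp)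
    (X : indepSets G) :
    restrictToComponent C (toggle (indepSets G) v X) = restrictToComponent C X := by
  apply Subtype.ext
  ext w
  change w.1 ∈ (toggle (indepSets G) v X).1 ↔ w.1 ∈ X.1
  rw [mem_toggle_indepSets]
  have : w.1 ≠ v := fun h => hv (h ▸ w.2)
  simp [this]

theorem restrictToComponent_bijective :
    Function.Bijective fun (X : indepSets G) (C : G.ConnectedComponent) =>
      restrictToComponent C X := by
  constructor
  · intro X Y h
    apply Subtype.ext
    ext v
    exact Set.ext_iff.1 (congrArg Subtype.val (congrFun h (G.connectedComponentMk v))) ⟨v, rfl⟩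
  · intro Y
    refine ⟨⟨{v | (⟨v, rfl⟩ : G.connectedComponentMk v) ∈ (Y (G.connectedComponentMk v)).1},
      fun u hu v hv huv hadj => ?_⟩, ?_⟩
    · have hC : G.connectedComponentMk v = G.connectedComponentMk u :=
        SimpleGraph.ConnectedComponent.eq.2 hadj.symm.reachable
      -- Generalizing the component allows transport along `hC` without a dependent rewrite.
      have key : ∀ (C : G.ConnectedComponent) (hC : G.connectedComponentMk v = C),
          (⟨v, hC⟩ : C) ∈ (Y C).1 := by rintro _ rfl; exact hv
      exact (Y (G.connectedComponentMk u)).2 hu (key _ hC) (fun h => huv (congrArg Subtype.val h))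
        hadj
    · funext C
      apply Subtype.ext
      ext ⟨v, hv⟩
      obtain rfl : G.connectedComponentMk v = C := hv
      rfl

/-- An independent set is the same as a choice of an independent set in every component. -/
noncomputable def indepSetsEquivPi (G : SimpleGraph V) :
    indepSets G ≃ ((C : G.ConnectedComponent) → indepSets C.toSimpleGraph) :=
  Equiv.ofBijective _ restrictToComponent_bijective

/-- The action of the product of the toggle groups of the components on the independent sets of
the whole graph. -/
noncomputable def piToggleHom (G : SimpleGraph V) :
    ((C : G.ConnectedComponent) → toggleGroup (indepSets C.toSimpleGraph)) →*
      Equiv.Perm (indepSets G) :=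
  (indepSetsEquivPi G).symm.permCongrHom.toMonoidHom.comp
    (toPermHom ((C : G.ConnectedComponent) → toggleGroup (indepSets C.toSimpleGraph))
      ((C : G.ConnectedComponent) → indepSets C.toSimpleGraph))

theorem restrictToComponent_piToggleHom
    (h : (C : G.ConnectedComponent) → toggleGroup (indepSets C.toSimpleGraph))
    (C : G.ConnectedComponent) (X : indepSets G) :
    restrictToComponent C (piToggleHom G h X) = (h C).1 (restrictToComponent C X) :=
  congrFun ((indepSetsEquivPi G).apply_symm_apply (h • indepSetsEquivPi G X)) C

theorem indepSets_ext {X Y : indepSets G}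
    (h : ∀ C, restrictToComponent C X = restrictToComponent C Y) : X = Y :=
  restrictToComponent_bijective.1 (funext h)

theorem piToggleHom_injective : Function.Injective (piToggleHom G) := by
  classical
  rw [injective_iff_map_eq_one]
  intro h hh
  funext C
  apply Subtype.ext
  ext1 Y
  obtain ⟨X, hX⟩ := restrictToComponent_bijective.2
    (Function.update (fun C => emptyIndepSet C.toSimpleGraph) C Y)
  have hX : restrictToComponent C X = Y := by simpa using congrFun hX C
  have := restrictToComponent_piToggleHom h C X
  rw [hh, hX] at this
  exact this.symm.trans hX

open scoped Classical in
theorem piToggleHom_mulSingle_toggle (C : G.ConnectedComponent) (v : C) :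
    piToggleHom G (Pi.mulSingle C ⟨_, toggle_mem_toggleGroup _ v⟩) =
      toggle (indepSets G) v.1 := by
  ext1 X
  refine indepSets_ext fun D => ?_
  rw [restrictToComponent_piToggleHom]
  by_cases h : D = C
  · subst h
    rw [Pi.mulSingle_eq_same, restrictToComponent_toggle]
  · rw [Pi.mulSingle_eq_of_ne h, restrictToComponent_toggle_of_notMem]
    · rfl
    · intro hv
      exact h (hv.symm.trans v.2)

open scoped Classical in
theorem piToggleHom_mulSingle_mem (C : G.ConnectedComponent)
    (g : toggleGroup (indepSets C.toSimpleGraph)) :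
    piToggleHom G (Pi.mulSingle C g) ∈ toggleGroup (indepSets G) := by
  obtain ⟨g, hg⟩ := g
  induction hg using Subgroup.closure_induction with
  | mem g hg =>
    obtain ⟨v, rfl⟩ := hg
    have := toggle_mem_toggleGroup (indepSets G) v.1
    rwa [← piToggleHom_mulSingle_toggle C v] at this
  | one =>
    have : piToggleHom G (Pi.mulSingle C 1) ∈ toggleGroup (indepSets G) := by
      rw [Pi.mulSingle_one, map_one]
      exact one_mem _
    exact this
  | mul x y hx hy ihx ihy =>
    have := mul_mem ihx ihy
    rwa [← map_mul, ← Pi.mulSingle_mul] at this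
  | inv x hx ih =>
    have := inv_mem ih
    rwa [← map_inv, ← Pi.mulSingle_inv] at this

theorem range_piToggleHom [Finite V] : (piToggleHom G).range = toggleGroup (indepSets G) := by
  classical
  apply le_antisymm
  · rintro _ ⟨h, rfl⟩
    exact Subgroup.pi_mem_of_mulSingle_mem (H := (toggleGroup (indepSets G)).comap (piToggleHom G))
      h fun C => piToggleHom_mulSingle_mem C (h C)
  · rw [toggleGroup, Subgroup.closure_le]
    rintro _ ⟨v, rfl⟩
    exact ⟨_, piToggleHom_mulSingle_toggle (G.connectedComponentMk v) ⟨v, rfl⟩⟩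

/-- The toggle group of the independent sets of a graph is the product of those of its
components. -/
noncomputable def toggleGroupEquivPi [Finite V] (G : SimpleGraph V) :
    toggleGroup (indepSets G) ≃*
      ((C : G.ConnectedComponent) → toggleGroup (indepSets C.toSimpleGraph)) :=
  (((piToggleHom G).ofInjective piToggleHom_injective).trans
    (MulEquiv.subgroupCongr range_piToggleHom)).symm

theorem toggleGroupEquivPi_apply_restrictToComponent [Finite V] (g : toggleGroup (indepSets G))
    (C : G.ConnectedComponent) (X : indepSets G) :
    (toggleGroupEquivPi G g C).1 (restrictToComponent C X) = restrictToComponent C (g.1 X) := by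
  rw [← restrictToComponent_piToggleHom]
  congr 2
  exact congrArg Subtype.val ((toggleGroupEquivPi G).symm_apply_apply g)

end Components

end ToggleGroup

theorem mainTheorem7 {V : Type*} [Finite V] (G : SimpleGraph V) :
    (G.Connected → ToggleGroup.ToggleAlternating (ToggleGroup.indepSets G)) ∧
    (∃ φ : ToggleGroup.toggleGroup (ToggleGroup.indepSets G) ≃*
        ((C : G.ConnectedComponent) →
          ToggleGroup.toggleGroup (ToggleGroup.indepSets C.toSimpleGraph)),
      ∀ (g : ToggleGroup.toggleGroup (ToggleGroup.indepSets G)) (C : G.ConnectedComponent)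
        (X : ToggleGroup.indepSets G),
        (φ g C).1 (ToggleGroup.restrictToComponent C X) =
          ToggleGroup.restrictToComponent C (g.1 X)) :=
  ⟨ToggleGroup.toggleAlternating_indepSets, ToggleGroup.toggleGroupEquivPi G,
    ToggleGroup.toggleGroupEquivPi_apply_restrictToComponent⟩
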